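/- Let $\Lambda=\Lambda_0\oplus\Lambda_1$ be a finite-dimensional real supercommutative superalgebra: a unital associative $\mathbb Z/2$-graded $\mathbb R$-algebra such that $ab=(-1)^{\sigma(a)\sigma(b)}ba$ for all homogeneous $a,b$ of parities $\sigma(a),\sigma(b)$. Endow $\Lambda$ with its usual finite-dimensional topology (any norm). Assume that the following bases are given. $(A_0)$ A basis $(e_0=1,e_1,\dots,e_p)$ of $\Lambda_0$ with $\sum_{k=0}^p e_k^2=0$. $(A_1)$ A basis $(\varepsilon_1,\dots,\varepsilon_q)$ of $\Lambda_1$, integers $1=s_1<s_2<\dots<s_r<s_{r+1}=q+1$ and elements $a_1,\dots,a_q\in\Lambda_0$ such that $a_{s_k}=1$ for $1\le k\le r$, $\varepsilon_j=a_j\varepsilon_{s_k}$ whenever $s_k\le j<s_{k+1}$, and $\sum_{j=s_k}^{s_{k+1}-1}a_j^2=0$ for every $k=1,\dots,r$. Write $y=\sum_k y^ke_k\in\Lambda_0$ and $\theta=\sum_j\theta^j\varepsilon_j\in\Lambda_1$ in real coordinates. For a $\Lambda$-valued function $f$ on an open set of $\Lambda_0$, respectively of $\Lambda_1$, that is Fréchet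 differentiable over $\mathbb R$, put $$d''f=\sum_{k=1}^p dy^k\Big(\frac{\partial f}{\partial y^k}-e_k\frac{\partial f}{\partial y^0}\Big),\qquad\text{respectively}\qquad d''f=\sum_{k=1}^r\ \sum_{j=s_k+1}^{s_{k+1}-1}d\theta^j\Big(\frac{\partial f}{\partial\theta^j}-a_j\frac{\partial f}{\partial\theta^{s_k}}\Big).$$ A function $f:D\to\Lambda$ on an open set $D$ of $\Lambda_0$ or of $\Lambda_1$ is called qS-differentiable on $D$ if it is Fréchet differentiable on $D$ and $d''f=0$ at every point of $D$. Let $D$ be an open set of $\Lambda_0$ or of $\Lambda_1$, and let $(f_n)$ be a sequence of qS-differentiable functions on $D$ with values in $\Lambda$ that converges to $f:D\to\Lambda$ uniformly on every compact subset of $D$. Then $f$ is qS-differentiable on $D$. -/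

import Mathlib

namespace Superanalysis

/-- A `ℤ/2`-graded algebra `Λ = Λ₀ ⊕ Λ₁` is supercommutative if the supercommutator
`ab - (-1)^{σ(a)σ(b)} ba` of any two homogeneous elements vanishes. -/
def IsSupercommutative {Λ : Type*} [Ring Λ] [Algebra ℝ Λ] (𝒜 : ZMod 2 → Submodule ℝ Λ) : Prop :=
  ∀ i j : ZMod 2, ∀ a ∈ 𝒜 i, ∀ b ∈ 𝒜 j, a * b = (-1) ^ (i.val * j.val) * (b * a)

section Even

variable {Λ : Type*} [NormedRing Λ] [NormedAlgebra ℝ Λ] {𝒜 : ZMod 2 → Submodule ℝ Λ} {p : ℕ}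

/-- Condition `(A₀)` for a basis `(e₀, …, e_p)` of `Λ₀`: `e₀ = 1` and `∑ e_k² = 0`. -/
def ConditionA0 (e : Module.Basis (Fin (p + 1)) ℝ (𝒜 0)) : Prop :=
  ((e 0 : 𝒜 0) : Λ) = 1 ∧ ∑ k, ((e k : 𝒜 0) : Λ) ^ 2 = 0

/-- The Cauchy-Riemann operator on functions of one variable `y = ∑ y^k e_k ∈ Λ₀`:
`d''f = ∑_{k=1}^p dy^k (∂f/∂y^k - e_k ∂f/∂y^0)`; `∂f/∂y^k` is the derivative along `e_k`. -/
noncomputable def dBarEven (e : Module.Basis (Fin (p + 1)) ℝ (𝒜 0)) (f : 𝒜 0 → Λ) (y : 𝒜 0) :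
    𝒜 0 →ₗ[ℝ] Λ :=
  ∑ k : Fin p, (e.coord k.succ).smulRight
    (fderiv ℝ f y (e k.succ) - ((e k.succ : 𝒜 0) : Λ) * fderiv ℝ f y (e 0))

/-- `f` is qS-differentiable on `D ⊆ Λ₀`: Fréchet differentiable with `d''f = 0` on `D`. -/
def QSDifferentiableOnEven (e : Module.Basis (Fin (p + 1)) ℝ (𝒜 0)) (f : 𝒜 0 → Λ)
    (D : Set (𝒜 0)) : Prop :=
  DifferentiableOn ℝ f D ∧ ∀ y ∈ D, dBarEven e f y = 0

end Even

section Odd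

/-- A basis `(ε_j)` of `Λ₁`, indexed by `0 ≤ j < q`, cut into `r` consecutive nonempty blocks
`s_k ≤ j < s_{k+1}` (`0 = s_0 < s_1 < ⋯ < s_r = q`), with elements `a_j ∈ Λ₀` such that
`a_{s_k} = 1` and `ε_j = a_j ε_{s_k}` for `j` in the `k`-th block. -/
structure OddBlockBasis {Λ : Type*} [Ring Λ] [Algebra ℝ Λ] (𝒜 : ZMod 2 → Submodule ℝ Λ)
    (q r : ℕ) where
  ε : Module.Basis (Fin q) ℝ (𝒜 1)
  s : Fin (r + 1) → ℕ
  s_strictMono : StrictMono s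
  s_zero : s 0 = 0
  s_last : s (Fin.last r) = q
  a : Fin q → Λ
  a_mem : ∀ j, a j ∈ 𝒜 0
  a_start : ∀ (k : Fin r) (j : Fin q), (j : ℕ) = s k.castSucc → a j = 1
  ε_eq : ∀ (k : Fin r) (i j : Fin q), (i : ℕ) = s k.castSucc → s k.castSucc ≤ (j : ℕ) →
    (j : ℕ) < s k.succ → ((ε j : 𝒜 1) : Λ) = a j * ((ε i : 𝒜 1) : Λ)

/-- The first index `s_k` of the `k`-th block, as an element of `Fin q`. -/
def OddBlockBasis.start {Λ : Type*} [Ring Λ] [Algebra ℝ Λ] {𝒜 : ZMod 2 → Submodule ℝ Λ}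
    {q r : ℕ} (B : OddBlockBasis 𝒜 q r) (k : Fin r) : Fin q :=
  ⟨B.s k.castSucc, lt_of_lt_of_eq (B.s_strictMono (Fin.castSucc_lt_last k)) B.s_last⟩

variable {Λ : Type*} [NormedRing Λ] [NormedAlgebra ℝ Λ] {𝒜 : ZMod 2 → Submodule ℝ Λ} {q r : ℕ}

/-- Condition `(A₁)`: the sum of the `a_j²` over each block vanishes. -/
def ConditionA1 (B : OddBlockBasis 𝒜 q r) : Prop :=
  ∀ k : Fin r, ∑ j ∈ Finset.univ.filter
    (fun j : Fin q => B.s k.castSucc ≤ (j : ℕ) ∧ (j : ℕ) < B.s k.succ), B.a j ^ 2 = 0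

/-- The Cauchy-Riemann operator on functions of one variable `θ = ∑ θ^j ε_j ∈ Λ₁`:
`d''f = ∑_k ∑_{s_k < j < s_{k+1}} dθ^j (∂f/∂θ^j - a_j ∂f/∂θ^{s_k})`; `∂f/∂θ^j` is the
derivative along `ε_j`. -/
noncomputable def dBarOdd (B : OddBlockBasis 𝒜 q r) (f : 𝒜 1 → Λ) (θ : 𝒜 1) : 𝒜 1 →ₗ[ℝ] Λ :=
  ∑ k : Fin r, ∑ j ∈ Finset.univ.filter
      (fun j : Fin q => B.s k.castSucc < (j : ℕ) ∧ (j : ℕ) < B.s k.succ),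
    (B.ε.coord j).smulRight
      (fderiv ℝ f θ (B.ε j) - B.a j * fderiv ℝ f θ (B.ε (B.start k)))

/-- `f` is qS-differentiable on `D ⊆ Λ₁`: Fréchet differentiable with `d''f = 0` on `D`. -/
def QSDifferentiableOnOdd (B : OddBlockBasis 𝒜 q r) (f : 𝒜 1 → Λ) (D : Set (𝒜 1)) : Prop :=
  DifferentiableOn ℝ f D ∧ ∀ θ ∈ D, dBarOdd B f θ = 0

end Odd

end Superanalysis

/-! In real coordinates both cases of `d''f = 0` are one system `∂_j f = A_j ∂_{σ j} f`, where `A_j`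
is multiplication by `e_j` or `a_j` and `σ j` is `0` or the start of the block of `j`. Conditions
`(A₀)` and `(A₁)` say that `∑ A_j² = 0` on each fibre of `σ`, so solutions are formally harmonic:
`∑_j ∂_j² f = ∑_i (∑_{σ j = i} A_j²) ∂_i² f = 0`.

Derivatives of solutions need not be continuous, so the limit is taken in the sense of
distributions. `isWeakSolution_of_differentiableOn` gives the weak form, by a divergence theorem
that does not need integrable partial derivatives, and `IsWeakSolution.of_tendsto` passes it to
locally uniform limits. It remains to prove that a continuous weak solution is differentiable.
`IsWeakSolution.integral_euler_radialBump` tests harmonicity against radial functions, whence a mean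
value property (`IsWeakSolution.integral_radialBump_eq`): locally `f` is its own convolution with a
radial `C¹` kernel. Differentiating the kernel gives `f'`, and the weak equation with the kernel as
test function gives the system. -/

open MeasureTheory Set Filter Topology Function

namespace Superanalysis

/-! ### Weak solutions and their stability under locally uniform limits -/

section Weak

variable {n : ℕ} {V : Type*} [NormedAddCommGroup V] [NormedSpace ℝ V]

/-- The divergence theorem for `∂_j w - A ∂_i w`, where `w` is compactly supported and merely
differentiable: only the combination itself is required to be continuous. -/
theorem integral_fderiv_single_sub_eq_zero [CompleteSpace V] {w : (Fin n → ℝ) → V}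
    (hw : Differentiable ℝ w) (hc : HasCompactSupport w) (i j : Fin n) (A : V →L[ℝ] V)
    (hcont : Continuous fun x =>
      fderiv ℝ w x (Pi.single j 1) - A (fderiv ℝ w x (Pi.single i 1))) :
    ∫ x, (fderiv ℝ w x (Pi.single j 1) - A (fderiv ℝ w x (Pi.single i 1))) = 0 := by
  obtain _ | m := n
  · exact i.elim0
  obtain ⟨R, hR0, hR⟩ : ∃ R : ℝ, 0 < R ∧ ∀ x, (∃ k, R ≤ |x k|) → x ∉ tsupport w := by
    obtain ⟨R, hR⟩ := hc.isCompact.isBounded.subset_closedBall (0 : Fin (m + 1) → ℝ)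
    refine ⟨max R 0 + 1, by positivity, fun x ⟨k, hk⟩ hx => ?_⟩
    have h1 : ‖x‖ ≤ R := by simpa using hR hx
    have h2 : |x k| ≤ ‖x‖ := norm_le_pi_norm x k
    have h3 := le_max_left R 0
    linarith
  have hw0 : ∀ x, (∃ k, R ≤ |x k|) → w x = 0 := fun x hx =>
    image_eq_zero_of_notMem_tsupport (hR x hx)
  let a : Fin (m + 1) → ℝ := fun _ => -R
  let b : Fin (m + 1) → ℝ := fun _ => R
  -- The field with `w` in slot `j` and `-A w` in slot `i` (added if `i = j`): its divergence is the
  -- integrand, and it vanishes on the faces of the cube.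
  let f : Fin (m + 1) → (Fin (m + 1) → ℝ) → V := fun k x =>
    (if k = j then w x else 0) - (if k = i then A (w x) else 0)
  let f' : Fin (m + 1) → (Fin (m + 1) → ℝ) → (Fin (m + 1) → ℝ) →L[ℝ] V := fun k x =>
    (if k = j then fderiv ℝ w x else 0) - (if k = i then A ∘L fderiv ℝ w x else 0)
  have hf : ∀ x k, HasFDerivAt (f k) (f' k x) x := fun x k => by
    have h := (hw x).hasFDerivAt
    refine HasFDerivAt.sub ?_ ?_
    · split_ifs
      exacts [h, hasFDerivAt_const _ _]
    · split_ifs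
      exacts [A.hasFDerivAt.comp x h, hasFDerivAt_const _ _]
  have hsum : ∀ x, ∑ k, f' k x (Pi.single k 1) =
      fderiv ℝ w x (Pi.single j 1) - A (fderiv ℝ w x (Pi.single i 1)) := fun x => by
    simp only [f', sub_apply, Finset.sum_sub_distrib]
    congr 1
    · rw [Finset.sum_eq_single j] <;> simp +contextual
    · rw [Finset.sum_eq_single i] <;> simp +contextual
  have hf0 : ∀ k x, (∃ k, R ≤ |x k|) → f k x = 0 := fun k x hx => by simp [f, hw0 x hx]
  -- This form asks for differentiability at every point and integrability of the divergence alone,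
  -- not of each partial derivative.
  have key := integral_divergence_of_hasFDerivAt_off_countable' a b
    (fun _ => by simp only [a, b]; linarith) f f' ∅ countable_empty
    (fun k x _ => (hf x k).continuousAt.continuousWithinAt)
    (fun x _ k => hf x k)
    (by simp only [hsum]; exact hcont.continuousOn.integrableOn_compact isCompact_Icc)
  simp only [hsum] at key
  rw [← setIntegral_eq_integral_of_forall_compl_eq_zero (s := Icc a b), key]
  · refine Finset.sum_eq_zero fun k _ => ?_
    have h1 : ∀ x, f k (k.insertNth (b k) x) = 0 := fun x =>
      hf0 _ _ ⟨k, by simpa [b] using le_abs_self R⟩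
    have h2 : ∀ x, f k (k.insertNth (a k) x) = 0 := fun x =>
      hf0 _ _ ⟨k, by simpa [a] using le_abs_self R⟩
    simp [h1, h2]
  · intro x hx
    have hx' : ∃ k, R ≤ |x k| := by
      by_contra! h
      exact hx ⟨fun k => (abs_lt.1 (h k)).1.le, fun k => (abs_lt.1 (h k)).2.le⟩
    have : fderiv ℝ w x = 0 := by
      by_contra h
      exact hR x hx' (support_fderiv_subset ℝ h)
    simp [this]

/-- `f` solves the first order system `∂_j f = A_j ∂_{σ j} f` on `U` in the sense of
distributions. -/
def IsWeakSolution (A : Fin n → V →L[ℝ] V) (σ : Fin n → Fin n) (f : (Fin n → ℝ) → V)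
    (U : Set (Fin n → ℝ)) : Prop :=
  ∀ (j : Fin n) (φ : (Fin n → ℝ) → ℝ), ContDiff ℝ 1 φ → HasCompactSupport φ → tsupport φ ⊆ U →
    ∫ x, fderiv ℝ φ x (Pi.single j 1) • f x = A j (∫ x, fderiv ℝ φ x (Pi.single (σ j) 1) • f x)

theorem continuous_smul_of_tsupport_subset {X : Type*} [TopologicalSpace X] {φ : X → ℝ} {f : X → V}
    {U : Set X} (hU : IsOpen U) (hf : ContinuousOn f U) (hφ : Continuous φ) (hs : tsupport φ ⊆ U) :
    Continuous fun x => φ x • f x :=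
  continuous_of_tsupport fun _ hx =>
    hφ.continuousAt.smul (hf.continuousAt (hU.mem_nhds (hs (tsupport_smul_subset_left φ f hx))))

theorem integrable_fderiv_smul {φ : (Fin n → ℝ) → ℝ} {f : (Fin n → ℝ) → V}
    {U : Set (Fin n → ℝ)} (hU : IsOpen U) (hf : ContinuousOn f U) (hφ : ContDiff ℝ 1 φ)
    (hc : HasCompactSupport φ) (hs : tsupport φ ⊆ U) (v : Fin n → ℝ) :
    Integrable fun x => fderiv ℝ φ x v • f x :=
  (continuous_smul_of_tsupport_subset hU hf
    ((hφ.continuous_fderiv one_ne_zero).clm_apply continuous_const)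
    ((tsupport_fderiv_apply_subset ℝ v).trans hs)).integrable_of_hasCompactSupport
    ((hc.fderiv_apply ℝ v).smul_right)

/-- A differentiable solution is a solution in the sense of distributions, although its
derivative need not be locally integrable. -/
theorem isWeakSolution_of_differentiableOn [CompleteSpace V] {A : Fin n → V →L[ℝ] V}
    {σ : Fin n → Fin n} {f : (Fin n → ℝ) → V} {U : Set (Fin n → ℝ)} (hU : IsOpen U)
    (hf : DifferentiableOn ℝ f U)
    (heq : ∀ x ∈ U, ∀ j, fderiv ℝ f x (Pi.single j 1) = A j (fderiv ℝ f x (Pi.single (σ j) 1))) :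
    IsWeakSolution A σ f U := by
  intro j φ hφ hc hs
  have hder : ∀ x, HasFDerivAt (fun x => φ x • f x)
      (φ x • fderiv ℝ f x + (fderiv ℝ φ x).smulRight (f x)) x := fun x => by
    by_cases hx : x ∈ tsupport φ
    · exact ((hφ.differentiable one_ne_zero) x).hasFDerivAt.smul
        (hf.differentiableAt (hU.mem_nhds (hs hx))).hasFDerivAt
    · have h0 : φ =ᶠ[𝓝 x] 0 := notMem_tsupport_iff_eventuallyEq.1 hx
      have h1 : fderiv ℝ φ x = 0 := by rw [h0.fderiv_eq]; simp
      have h2 : φ x = 0 := h0.eq_of_nhds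
      rw [h1, h2]
      refine HasFDerivAt.congr_of_eventuallyEq (f := fun _ => (0 : V)) ?_
        (h0.mono fun y hy => by simp [hy])
      simpa using hasFDerivAt_const (0 : V) x
  -- The terms that contain derivatives of `f` cancel by the equation; what is left is continuous
  -- even though `fderiv ℝ f` may not be.
  have hpt : ∀ x, fderiv ℝ (fun x => φ x • f x) x (Pi.single j 1) -
      A j (fderiv ℝ (fun x => φ x • f x) x (Pi.single (σ j) 1)) =
      fderiv ℝ φ x (Pi.single j 1) • f x - A j (fderiv ℝ φ x (Pi.single (σ j) 1) • f x) := by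
    intro x
    rw [(hder x).fderiv]
    by_cases hx : x ∈ tsupport φ
    · simp [heq x (hs hx) j]
    · simp [image_eq_zero_of_notMem_tsupport hx]
  have hint := integrable_fderiv_smul hU hf.continuousOn hφ hc hs
  have hcont : ∀ v, Continuous fun x => fderiv ℝ φ x v • f x := fun v =>
    continuous_smul_of_tsupport_subset hU hf.continuousOn
      ((hφ.continuous_fderiv one_ne_zero).clm_apply continuous_const)
      ((tsupport_fderiv_apply_subset ℝ v).trans hs)
  have key := integral_fderiv_single_sub_eq_zero (w := fun x => φ x • f x)
    (fun x => (hder x).differentiableAt) hc.smul_right (σ j) j (A j)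
    (by simp only [hpt]; exact (hcont _).sub ((A j).continuous.comp (hcont _)))
  simp only [hpt] at key
  rw [integral_sub (hint _) ((A j).integrable_comp (hint _)),
    (A j).integral_comp_comm (hint _), sub_eq_zero] at key
  exact key

theorem tendsto_integral_smul_of_tendstoUniformlyOn {ψ : (Fin n → ℝ) → ℝ}
    {F : ℕ → (Fin n → ℝ) → V} {f : (Fin n → ℝ) → V} (hψ : Continuous ψ)
    (hc : HasCompactSupport ψ) (hF : ∀ k, Integrable fun x => ψ x • F k x)
    (hf : ContinuousOn f (tsupport ψ)) (hlim : TendstoUniformlyOn F f atTop (tsupport ψ)) :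
    Tendsto (fun k => ∫ x, ψ x • F k x) atTop (𝓝 (∫ x, ψ x • f x)) := by
  obtain ⟨C, hC⟩ := hc.isCompact.exists_bound_of_continuousOn hf
  refine tendsto_integral_filter_of_dominated_convergence (fun x => ‖ψ x‖ * (C + 1))
    (Eventually.of_forall fun k => (hF k).aestronglyMeasurable) ?_ ?_ ?_
  · filter_upwards [Metric.tendstoUniformlyOn_iff.1 hlim 1 one_pos] with k hk
    refine Eventually.of_forall fun x => ?_
    by_cases hx : x ∈ tsupport ψ
    · rw [norm_smul]
      have h1 := hk x hx
      have h2 := hC x hx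
      rw [dist_comm, dist_eq_norm] at h1
      have h3 : ‖F k x‖ ≤ ‖F k x - f x‖ + ‖f x‖ := by simpa using norm_add_le (F k x - f x) (f x)
      gcongr
      linarith
    · simp [image_eq_zero_of_notMem_tsupport hx]
  · exact (hψ.norm.integrable_of_hasCompactSupport hc.norm).mul_const _
  · refine Eventually.of_forall fun x => ?_
    by_cases hx : x ∈ tsupport ψ
    · exact (hlim.tendsto_at hx).const_smul _
    · simp [image_eq_zero_of_notMem_tsupport hx]

/-- The derivatives fall on the test function, so uniform convergence on its support suffices to
pass to the limit on both sides. -/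
theorem IsWeakSolution.of_tendsto {A : Fin n → V →L[ℝ] V}
    {σ : Fin n → Fin n} {F : ℕ → (Fin n → ℝ) → V} {f : (Fin n → ℝ) → V} {U : Set (Fin n → ℝ)}
    (hU : IsOpen U) (hF : ∀ k, IsWeakSolution A σ (F k) U) (hFc : ∀ k, ContinuousOn (F k) U)
    (hf : ContinuousOn f U)
    (hlim : ∀ K ⊆ U, IsCompact K → TendstoUniformlyOn F f atTop K) : IsWeakSolution A σ f U := by
  intro j φ hφ hc hs
  have h : ∀ v, Tendsto (fun k => ∫ x, fderiv ℝ φ x v • F k x) atTop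
      (𝓝 (∫ x, fderiv ℝ φ x v • f x)) := fun v => by
    have hsub := (tsupport_fderiv_apply_subset ℝ v (f := φ)).trans hs
    exact tendsto_integral_smul_of_tendstoUniformlyOn
      ((hφ.continuous_fderiv one_ne_zero).clm_apply continuous_const) (hc.fderiv_apply ℝ v)
      (fun k => integrable_fderiv_smul hU (hFc k) hφ hc hs v) (hf.mono hsub)
      (hlim _ hsub (hc.fderiv_apply ℝ v))
  refine tendsto_nhds_unique (h _) ?_
  simp only [fun k => hF k j φ hφ hc hs]
  exact ((A j).continuous.tendsto _).comp (h _)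

end Weak

/-! ### Radial kernels, the mean value property and regularity -/

section Regularity

variable {n : ℕ}

/-- The profile of a radial bump function, as a function of the squared radius. -/
noncomputable def radialProfile (u : ℝ) : ℝ := Real.smoothTransition (1 - u)

theorem contDiff_radialProfile : ContDiff ℝ 2 radialProfile :=
  (Real.smoothTransition.contDiff (n := 2)).comp (contDiff_const.sub contDiff_id)

theorem radialProfile_eq_zero {u : ℝ} (hu : 1 ≤ u) : radialProfile u = 0 :=
  Real.smoothTransition.zero_of_nonpos (by linarith)

theorem hasDerivAt_radialProfile (u : ℝ) :
    HasDerivAt radialProfile (deriv radialProfile u) u :=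
  (contDiff_radialProfile.differentiable two_ne_zero u).hasDerivAt

theorem contDiff_deriv_radialProfile : ContDiff ℝ 1 (deriv radialProfile) :=
  (contDiff_succ_iff_deriv (n := 1).1 (by exact contDiff_radialProfile)).2.2

theorem deriv_radialProfile_eq_zero {u : ℝ} (hu : 1 < u) : deriv radialProfile u = 0 := by
  have : radialProfile =ᶠ[𝓝 u] fun _ => 0 :=
    (eventually_gt_nhds hu).mono fun v hv => radialProfile_eq_zero hv.le
  rw [this.deriv_eq, deriv_const]

/-- The bump function `η(t² |x|²)` for the Euclidean norm, supported in `|x| ≤ 1 / t`. -/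
noncomputable def radialBump (t : ℝ) (x : Fin n → ℝ) : ℝ := radialProfile (t ^ 2 * ∑ i, x i ^ 2)

theorem contDiff_sum_sq : ContDiff ℝ 2 fun x : Fin n → ℝ => ∑ i, x i ^ 2 := by
  fun_prop

theorem contDiff_radialBump (t : ℝ) : ContDiff ℝ 2 (radialBump (n := n) t) :=
  contDiff_radialProfile.comp (contDiff_const.mul contDiff_sum_sq)

theorem radialBump_nonneg (t : ℝ) (x : Fin n → ℝ) : 0 ≤ radialBump t x :=
  Real.smoothTransition.nonneg _

theorem radialBump_smul (t : ℝ) (x : Fin n → ℝ) : radialBump 1 (t • x) = radialBump t x := by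
  simp [radialBump, mul_pow, Finset.mul_sum]

theorem support_radialBump_subset {t : ℝ} (ht : 0 < t) :
    support (radialBump (n := n) t) ⊆ Metric.closedBall 0 t⁻¹ := by
  intro x hx
  rw [mem_closedBall_zero_iff, pi_norm_le_iff_of_nonneg (by positivity)]
  intro i
  by_contra! h
  refine hx (radialProfile_eq_zero ?_)
  have h1 : x i ^ 2 ≤ ∑ i, x i ^ 2 :=
    Finset.single_le_sum (f := fun i => x i ^ 2) (fun i _ => sq_nonneg _) (Finset.mem_univ i)
  have h2 : (t⁻¹) ^ 2 ≤ x i ^ 2 := by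
    rw [← sq_abs (x i)]
    exact pow_le_pow_left₀ (by positivity) h.le 2
  calc (1 : ℝ) = t ^ 2 * (t⁻¹) ^ 2 := by field_simp
    _ ≤ _ := by gcongr; exact h2.trans h1

theorem tsupport_radialBump_subset {t : ℝ} (ht : 0 < t) :
    tsupport (radialBump (n := n) t) ⊆ Metric.closedBall 0 t⁻¹ :=
  closure_minimal (support_radialBump_subset ht) Metric.isClosed_closedBall

theorem hasCompactSupport_radialBump {t : ℝ} (ht : 0 < t) :
    HasCompactSupport (radialBump (n := n) t) :=
  .of_support_subset_isCompact (isCompact_closedBall _ _) (support_radialBump_subset ht)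

theorem integral_radialBump_pos : 0 < ∫ x : Fin n → ℝ, radialBump 1 x :=
  (contDiff_radialBump 1).continuous.integral_pos_of_hasCompactSupport_nonneg_nonzero
    (hasCompactSupport_radialBump one_pos) (radialBump_nonneg 1) (x := 0)
    (by simp [radialBump, radialProfile])

theorem integral_pow_mul_radialBump {t : ℝ} (ht : 0 < t) :
    ∫ x : Fin n → ℝ, t ^ n * radialBump t x = ∫ x : Fin n → ℝ, radialBump 1 x := by
  simp only [← radialBump_smul t]
  rw [integral_const_mul, Measure.integral_comp_smul]
  simp only [Module.finrank_fin_fun, smul_eq_mul]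
  rw [abs_of_pos (by positivity), mul_inv_cancel_left₀ (by positivity)]

theorem hasFDerivAt_radialBump (t : ℝ) (x : Fin n → ℝ) :
    HasFDerivAt (radialBump t) ((deriv radialProfile (t ^ 2 * ∑ i, x i ^ 2) * t ^ 2) •
      ∑ i, (2 * x i) • ContinuousLinearMap.proj (R := ℝ) (φ := fun _ : Fin n => ℝ) i) x := by
  have h1 : HasFDerivAt (fun x : Fin n → ℝ => ∑ i, x i ^ 2)
      (∑ i, (2 * x i) • ContinuousLinearMap.proj (R := ℝ) (φ := fun _ : Fin n => ℝ) i) x := by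
    refine HasFDerivAt.fun_sum fun i _ => ?_
    simpa using (hasFDerivAt_apply (𝕜 := ℝ) (F' := fun _ : Fin n => ℝ) i x).pow 2
  have h2 := (hasDerivAt_radialProfile (t ^ 2 * ∑ i, x i ^ 2)).comp_hasFDerivAt x
    (h1.const_mul (t ^ 2))
  rw [smul_smul] at h2
  exact h2

/-- The field `x ↦ x η(t²|x|²)` is the gradient of a radial function, hence the symmetry in `i` and
`j` on which the harmonicity argument rests. -/
theorem fderiv_coord_mul_radialBump (t : ℝ) (x : Fin n → ℝ) (i j : Fin n) :
    fderiv ℝ (fun x => x j * radialBump t x) x (Pi.single i 1) =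
      (if i = j then radialBump t x else 0) +
        2 * t ^ 2 * (x i * x j) * deriv radialProfile (t ^ 2 * ∑ i, x i ^ 2) := by
  have h := (hasFDerivAt_apply (𝕜 := ℝ) (F' := fun _ : Fin n => ℝ) j x).mul
    (hasFDerivAt_radialBump t x)
  rw [HasFDerivAt.fderiv (f := fun x => x j * radialBump t x) h]
  simp [Pi.single_apply, eq_comm (a := i)]
  split_ifs <;> ring

variable {V : Type*} [NormedAddCommGroup V] [NormedSpace ℝ V]
  {A : Fin n → V →L[ℝ] V} {σ : Fin n → Fin n} {f g : (Fin n → ℝ) → V} {U : Set (Fin n → ℝ)}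

theorem IsWeakSolution.integral_comp_sub (hg : IsWeakSolution A σ g U)
    {F : (Fin n → ℝ) → ℝ} (hF : ContDiff ℝ 1 F) {r : ℝ}
    (hr : tsupport F ⊆ Metric.closedBall 0 r) {y : Fin n → ℝ}
    (hy : Metric.closedBall y r ⊆ U) (j : Fin n) :
    ∫ x, fderiv ℝ F (y - x) (Pi.single j 1) • g x =
      A j (∫ x, fderiv ℝ F (y - x) (Pi.single (σ j) 1) • g x) := by
  have hsupp : tsupport (fun x => F (y - x)) ⊆ Metric.closedBall y r := by
    refine closure_minimal (fun x hx => ?_) Metric.isClosed_closedBall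
    have := hr (subset_tsupport _ hx)
    rwa [mem_closedBall_zero_iff, ← dist_eq_norm, dist_comm, ← Metric.mem_closedBall] at this
  have hder : ∀ x v, fderiv ℝ (fun x => F (y - x)) x v = -fderiv ℝ F (y - x) v := fun x v => by
    have h := ((hF.differentiable one_ne_zero) (y - x)).hasFDerivAt.comp x
      ((hasFDerivAt_id x).const_sub y)
    rw [HasFDerivAt.fderiv (f := fun x => F (y - x)) h]
    simp
  have key := hg j (fun x => F (y - x)) (hF.comp (contDiff_const.sub contDiff_id))
    (.of_support_subset_isCompact (isCompact_closedBall y r) ((subset_tsupport _).trans hsupp))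
    (hsupp.trans hy)
  simpa [hder, integral_neg] using key

theorem integrable_comp_sub_smul {ψ : (Fin n → ℝ) → ℝ} (hψ : Continuous ψ)
    (hc : HasCompactSupport ψ) (hg : Integrable g) (y : Fin n → ℝ) :
    Integrable fun x => ψ (y - x) • g x := by
  obtain ⟨C, hC⟩ := hc.exists_bound_of_continuous hψ
  exact hg.bdd_smul C (hψ.comp (continuous_const.sub continuous_id)).aestronglyMeasurable
    (Eventually.of_forall fun x => hC _)

theorem coord_mul_radialBump_contDiff (t : ℝ) (j : Fin n) :
    ContDiff ℝ 2 fun x => x j * radialBump t x :=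
  (contDiff_apply ℝ ℝ j).mul (contDiff_radialBump t)

/-- Weak solutions are weakly harmonic when the operators `A_j ^ 2` add up to zero on each fibre
of `σ`; here this is tested against the Laplacian of a radial function. -/
theorem IsWeakSolution.integral_euler_radialBump (hg : IsWeakSolution A σ g U)
    (hgi : Integrable g)
    (hA : ∀ i v, ∑ j with σ j = i, A j (A j v) = 0) {t : ℝ} (ht : 0 < t) {y : Fin n → ℝ}
    (hy : Metric.closedBall y t⁻¹ ⊆ U) :
    ∫ x, (n * radialBump t (y - x) + 2 * t ^ 2 * (∑ i, (y - x) i ^ 2) *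
      deriv radialProfile (t ^ 2 * ∑ i, (y - x) i ^ 2)) • g x = 0 := by
  let F : Fin n → (Fin n → ℝ) → ℝ := fun j x => x j * radialBump t x
  have hF1 : ∀ j, ContDiff ℝ 1 (F j) := fun j =>
    (coord_mul_radialBump_contDiff t j).of_le one_le_two
  have hFs : ∀ j, tsupport (F j) ⊆ Metric.closedBall 0 t⁻¹ := fun j =>
    (tsupport_mul_subset_right (f := fun x : Fin n → ℝ => x j)).trans (tsupport_radialBump_subset ht)
  have hFc : ∀ j, HasCompactSupport (F j) := fun j => (hasCompactSupport_radialBump ht).mul_left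
  let I : Fin n → Fin n → V := fun i j => ∫ x, fderiv ℝ (F j) (y - x) (Pi.single i 1) • g x
  have hweak : ∀ i j, I j i = A j (I (σ j) i) := fun i j =>
    hg.integral_comp_sub (hF1 i) (hFs i) hy j
  have hsymm : ∀ i j, I i j = I j i := fun i j => by
    simp only [I, F, fderiv_coord_mul_radialBump, eq_comm (a := i), mul_comm ((y - _ : Fin n → ℝ) i)]
  -- Equation, symmetry, equation again: the weak counterpart of `∂_j² = A_j² ∂_{σ j}²`.
  have hdiag : ∀ j, I j j = A j (A j (I (σ j) (σ j))) := fun j => by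
    rw [hweak j j, hsymm, hweak (σ j) j]
  have hsum : ∑ j, I j j = 0 := by
    calc ∑ j, I j j = ∑ i, ∑ j with σ j = i, I j j := (Finset.sum_fiberwise _ _ _).symm
      _ = ∑ i, ∑ j with σ j = i, A j (A j (I i i)) := by
        refine Finset.sum_congr rfl fun i _ => Finset.sum_congr rfl fun j hj => ?_
        rw [hdiag j, (Finset.mem_filter.1 hj).2]
      _ = 0 := Finset.sum_eq_zero fun i _ => hA i _
  rw [← hsum]
  simp only [I]
  rw [← integral_finsetSum _ fun j _ => integrable_comp_sub_smul
    (((hF1 j).continuous_fderiv one_ne_zero).clm_apply continuous_const)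
    ((hFc j).fderiv_apply ℝ _) hgi y]
  refine integral_congr_ae (Eventually.of_forall fun x => ?_)
  simp only [F, fderiv_coord_mul_radialBump, ← Finset.sum_smul, if_true, Finset.sum_add_distrib]
  congr 2
  · simp
  · simp only [← Finset.sum_mul, ← Finset.mul_sum, pow_two]

/-- Up to the factor `t ^ n * t⁻¹`, changing the scale produces the divergence of `x η(t²|x|²)`, the
function that weak solutions annihilate. -/
theorem hasDerivAt_pow_mul_radialBump {t : ℝ} (ht : 0 < t) (z : Fin n → ℝ) :
    HasDerivAt (fun t => t ^ n * radialBump t z) (t ^ n * t⁻¹ * (n * radialBump t z +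
      2 * t ^ 2 * (∑ i, z i ^ 2) * deriv radialProfile (t ^ 2 * ∑ i, z i ^ 2))) t := by
  have h := (hasDerivAt_pow n t).mul ((hasDerivAt_radialProfile (t ^ 2 * ∑ i, z i ^ 2)).comp t
    ((hasDerivAt_pow 2 t).mul_const (∑ i, z i ^ 2)))
  refine h.congr_deriv ?_
  have h1 : (n : ℝ) * t ^ (n - 1) = t ^ n * t⁻¹ * n := by
    obtain _ | m := n
    · simp
    · rw [Nat.add_sub_cancel, pow_succ]
      field_simp
  rw [h1]
  simp only [radialBump, Function.comp]
  field_simp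
  push_cast
  ring

theorem exists_bound_euler_radialProfile :
    ∃ C, ∀ u, 0 ≤ u → |n * radialProfile u + 2 * u * deriv radialProfile u| ≤ C := by
  have hc : Continuous fun u => n * radialProfile u + 2 * u * deriv radialProfile u := by
    have h1 := contDiff_radialProfile.continuous
    have h2 := contDiff_deriv_radialProfile.continuous
    fun_prop
  obtain ⟨C, hC⟩ := (isCompact_Icc (a := (0 : ℝ)) (b := 1)).exists_bound_of_continuousOn
    hc.continuousOn
  refine ⟨C, fun u hu => ?_⟩
  obtain h | h := le_or_gt u 1
  · exact hC u ⟨hu, h⟩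
  · rw [radialProfile_eq_zero h.le, deriv_radialProfile_eq_zero h]
    simpa using (norm_nonneg _).trans (hC 0 ⟨le_rfl, zero_le_one⟩)

theorem hasDerivAt_integral_radialBump (hgi : Integrable g) {t : ℝ} (ht : 0 < t)
    (y : Fin n → ℝ) :
    HasDerivAt (fun t => ∫ x, (t ^ n * radialBump t (y - x)) • g x)
      (∫ x, (t ^ n * t⁻¹ * (n * radialBump t (y - x) + 2 * t ^ 2 * (∑ i, (y - x) i ^ 2) *
        deriv radialProfile (t ^ 2 * ∑ i, (y - x) i ^ 2))) • g x) t := by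
  obtain ⟨C, hC⟩ := exists_bound_euler_radialProfile (n := n)
  have hint : ∀ s : ℝ, 0 < s → Integrable fun x => (s ^ n * radialBump s (y - x)) • g x :=
    fun s hs => integrable_comp_sub_smul (ψ := fun z => s ^ n * radialBump s z)
      (continuous_const.mul (contDiff_radialBump s).continuous)
      (hasCompactSupport_radialBump hs).mul_left hgi y
  -- For `s` in `(t/2, 2t)`, `s ^ n` and `s⁻¹` are bounded by their values at the ends, and the
  -- remaining factor by `C`, uniformly in `x`.
  refine (hasDerivAt_integral_of_dominated_loc_of_deriv_le
    (F := fun t x => (t ^ n * radialBump t (y - x)) • g x)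
    (F' := fun t x => (t ^ n * t⁻¹ * (n * radialBump t (y - x) + 2 * t ^ 2 * (∑ i, (y - x) i ^ 2) *
        deriv radialProfile (t ^ 2 * ∑ i, (y - x) i ^ 2))) • g x)
    (s := Ioo (t / 2) (2 * t))
    (bound := fun x => ((2 * t) ^ n * (t / 2)⁻¹ * C) * ‖g x‖)
    (Ioo_mem_nhds (by linarith) (by linarith)) ?_ (hint t ht) ?_ ?_ (hgi.norm.const_mul _) ?_).2
  · filter_upwards [lt_mem_nhds ht] with s hs using (hint s hs).aestronglyMeasurable
  · refine AEStronglyMeasurable.smul (Continuous.aestronglyMeasurable ?_) hgi.aestronglyMeasurable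
    have h1 := (contDiff_radialBump (n := n) t).continuous
    have h2 := contDiff_deriv_radialProfile.continuous
    fun_prop
  · refine Eventually.of_forall fun x s hs => ?_
    have hs0 : 0 < s := by linarith [hs.1]
    rw [norm_smul, norm_mul, norm_mul]
    have h1 := hC (s ^ 2 * ∑ i, (y - x) i ^ 2)
      (mul_nonneg (sq_nonneg _) (Finset.sum_nonneg fun i _ => sq_nonneg _))
    rw [← mul_assoc 2] at h1
    rw [Real.norm_of_nonneg (by positivity), Real.norm_of_nonneg (by positivity)]
    have h2 : s ^ n ≤ (2 * t) ^ n := pow_le_pow_left₀ hs0.le hs.2.le n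
    have h3 : s⁻¹ ≤ (t / 2)⁻¹ := inv_anti₀ (by linarith) hs.1.le
    gcongr
    exact h1
  · refine Eventually.of_forall fun x s hs => ?_
    exact (hasDerivAt_pow_mul_radialBump (by linarith [hs.1]) (y - x)).smul_const (g x)

/-- Divided by their common integral, the rescaled bumps form an approximate identity. -/
theorem tendsto_integral_radialBump [CompleteSpace V] (hgi : Integrable g) {y : Fin n → ℝ}
    (hgc : ContinuousAt g y) :
    Tendsto (fun t : ℝ => ∫ x, (t ^ n * radialBump t (y - x)) • g x) atTop
      (𝓝 ((∫ x : Fin n → ℝ, radialBump 1 x) • g y)) := by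
  set c := ∫ x : Fin n → ℝ, radialBump 1 x with hc
  have hc0 : 0 < c := integral_radialBump_pos
  have h := convolution_tendsto_right (μ := (volume : Measure (Fin n → ℝ))) (l := atTop)
    (φ := fun t x => c⁻¹ * (t ^ n * radialBump t x)) (g := fun _ : ℝ => g) (k := fun _ => y)
    (x₀ := y) (z₀ := g y)
    ((eventually_gt_atTop 0).mono fun t ht x => by
      have := radialBump_nonneg t x
      positivity)
    ((eventually_gt_atTop 0).mono fun t ht => by
      rw [integral_const_mul, integral_pow_mul_radialBump ht, ← hc, inv_mul_cancel₀ hc0.ne'])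
    ?_ (Eventually.of_forall fun _ => hgi.aestronglyMeasurable) (hgc.tendsto.comp tendsto_snd)
    tendsto_const_nhds
  · have h' := h.const_smul c
    refine h'.congr fun t => ?_
    rw [convolution_lsmul, ← integral_smul, ← integral_sub_left_eq_self _ _ y]
    refine integral_congr_ae (Eventually.of_forall fun x => ?_)
    simp only [sub_sub_cancel, smul_smul, mul_inv_cancel_left₀ hc0.ne']
  · rw [tendsto_smallSets_iff]
    intro s hs
    obtain ⟨ε, hε, hs⟩ := Metric.nhds_basis_closedBall.mem_iff.1 hs
    filter_upwards [eventually_gt_atTop ε⁻¹] with t ht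
    have ht0 : 0 < t := (inv_pos.2 hε).trans ht
    intro x hx
    refine hs (Metric.closedBall_subset_closedBall (inv_le_of_inv_le₀ hε ht.le)
      (support_radialBump_subset ht0 ?_))
    intro h0
    exact hx (by simp [h0])

/-- The left side has zero derivative in the scale on `(t₀, ∞)`, so it equals its limit at infinity.
-/
theorem IsWeakSolution.integral_radialBump_eq [CompleteSpace V] (hg : IsWeakSolution A σ g U)
    (hgi : Integrable g) (hA : ∀ i v, ∑ j with σ j = i, A j (A j v) = 0) {t₀ t : ℝ} (ht₀ : 0 < t₀)
    (ht : t₀ < t) {y : Fin n → ℝ} (hy : Metric.closedBall y t₀⁻¹ ⊆ U) (hgc : ContinuousAt g y) :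
    ∫ x, (t ^ n * radialBump t (y - x)) • g x = (∫ x : Fin n → ℝ, radialBump 1 x) • g y := by
  have hder : ∀ s ∈ Ioi t₀,
      HasDerivAt (fun t => ∫ x, (t ^ n * radialBump t (y - x)) • g x) 0 s := fun s hs => by
    have hs0 : 0 < s := ht₀.trans hs
    refine (hasDerivAt_integral_radialBump hgi hs0 y).congr_deriv ?_
    simp only [mul_smul (s ^ n * s⁻¹)]
    rw [integral_smul, hg.integral_euler_radialBump hgi hA hs0
      ((Metric.closedBall_subset_closedBall (inv_anti₀ ht₀ (le_of_lt hs))).trans hy), smul_zero]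
  refine tendsto_nhds_unique (tendsto_const_nhds.congr' ?_) (tendsto_integral_radialBump hgi hgc)
  filter_upwards [eventually_gt_atTop t₀] with s hs
  exact isOpen_Ioi.is_const_of_deriv_eq_zero isPreconnected_Ioi
    (fun s hs => (hder s hs).differentiableAt.differentiableWithinAt)
    (fun s hs => (hder s hs).deriv) ht hs

/-- Regularity of continuous weak solutions of `∂_j f = A_j ∂_{σ j} f`. -/
theorem IsWeakSolution.exists_hasFDerivAt [CompleteSpace V] (hf : IsWeakSolution A σ f U)
    (hU : IsOpen U) (hfc : ContinuousOn f U) (hA : ∀ i v, ∑ j with σ j = i, A j (A j v) = 0)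
    {y : Fin n → ℝ} (hy : y ∈ U) :
    ∃ f' : (Fin n → ℝ) →L[ℝ] V, HasFDerivAt f f' y ∧
      ∀ j, f' (Pi.single j 1) = A j (f' (Pi.single (σ j) 1)) := by
  obtain ⟨R, hR, hRU⟩ := Metric.nhds_basis_closedBall.mem_iff.1 (hU.mem_nhds hy)
  set K := Metric.closedBall y R with hK
  -- Truncation gives a globally integrable function without affecting test functions supported in
  -- `K`.
  set g := K.indicator f with hg_def
  have hgi : Integrable g :=
    ((hfc.mono hRU).integrableOn_compact (isCompact_closedBall _ _)).integrable_indicator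
      Metric.isClosed_closedBall.measurableSet
  have hg : IsWeakSolution A σ g K := by
    intro j φ hφ hc hs
    have : ∀ v x, fderiv ℝ φ x v • g x = fderiv ℝ φ x v • f x := fun v x => by
      by_cases hx : x ∈ K
      · rw [hg_def, indicator_of_mem hx]
      · have h0 := image_eq_zero_of_notMem_tsupport
          fun h => hx (hs (tsupport_fderiv_apply_subset ℝ v h))
        simp only [h0, zero_smul]
    simp only [this]
    exact hf j φ hφ hc (hs.trans hRU)
  have hgf : ∀ x ∈ Metric.ball y R, g x = f x := fun x hx =>
    indicator_of_mem (Metric.ball_subset_closedBall hx) f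
  have hgc : ∀ x ∈ Metric.ball y R, ContinuousAt g x := fun x hx =>
    (hfc.continuousAt (hU.mem_nhds (hRU (Metric.ball_subset_closedBall hx)))).congr
      ((eventually_mem_nhds_iff.2 (Metric.isOpen_ball.mem_nhds hx)).mono fun z hz =>
        (hgf z (mem_of_mem_nhds hz)).symm)
  -- The mean value property is applied with `t₀ = (R / 2)⁻¹`; the `+ 1` makes `t₀ < t` strict. One
  -- kernel then serves all centres within `R / 2` of `y`.
  set t : ℝ := (R / 2)⁻¹ + 1 with ht_def
  have hR2 : 0 < (R / 2)⁻¹ := by positivity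
  have ht0 : 0 < t := by linarith
  have htR : t⁻¹ ≤ R / 2 := inv_le_of_inv_le₀ (by positivity) (by linarith)
  have hball : ∀ z ∈ Metric.ball y (R / 2), Metric.closedBall z (R / 2) ⊆ K := fun z hz =>
    Metric.closedBall_subset_closedBall' (by linarith [Metric.mem_ball.1 hz])
  set ρ : (Fin n → ℝ) → ℝ := fun z => t ^ n * radialBump t z with hρ_def
  have hρ : ContDiff ℝ 1 ρ := contDiff_const.mul ((contDiff_radialBump t).of_le one_le_two)
  have hρc : HasCompactSupport ρ := (hasCompactSupport_radialBump ht0).mul_left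
  have hρs : tsupport ρ ⊆ Metric.closedBall 0 (R / 2) :=
    (tsupport_mul_subset_right (f := fun _ : Fin n → ℝ => t ^ n)).trans
      ((tsupport_radialBump_subset ht0).trans (Metric.closedBall_subset_closedBall htR))
  set c := ∫ x : Fin n → ℝ, radialBump 1 x with hc
  have hc0 : c ≠ 0 := integral_radialBump_pos.ne'
  let L : V →L[ℝ] ℝ →L[ℝ] V := (ContinuousLinearMap.lsmul ℝ ℝ).flip
  have hconv : f =ᶠ[𝓝 y] fun z => c⁻¹ • convolution g ρ L volume z := by
    filter_upwards [Metric.ball_mem_nhds y (half_pos hR)] with z hz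
    have hz' : z ∈ Metric.ball y R := Metric.ball_subset_ball (by linarith) hz
    have h := hg.integral_radialBump_eq hgi hA hR2 (t := t) (by linarith)
      (by rw [inv_inv]; exact hball z hz) (hgc z hz')
    rw [← hgf z hz', eq_inv_smul_iff₀ hc0, ← h]
    rfl
  refine ⟨_, ((hρc.hasFDerivAt_convolution_right L hgi.locallyIntegrable hρ y).const_smul
    c⁻¹).congr_of_eventuallyEq hconv, fun j => ?_⟩
  have happ : ∀ v, convolution g (fderiv ℝ ρ) (L.precompR (Fin n → ℝ)) volume y v =
      ∫ x, fderiv ℝ ρ (y - x) v • g x := fun v =>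
    convolution_precompR_apply L hgi.locallyIntegrable (hρc.fderiv ℝ)
      (hρ.continuous_fderiv one_ne_zero) y v
  simp only [smul_apply, happ, map_smul]
  rw [hg.integral_comp_sub hρ hρs (hball y (Metric.mem_ball_self (by positivity)))]

/-- Locally uniform limits of differentiable solutions of `∂_j f = A_j ∂_{σ j} f` are
differentiable solutions. -/
theorem hasFDerivAt_of_tendstoUniformlyOn_compact {E : Type*} [NormedAddCommGroup E]
    [NormedSpace ℝ E] [CompleteSpace V] (b : Module.Basis (Fin n) ℝ E)
    (hA : ∀ i v, ∑ j with σ j = i, A j (A j v) = 0) {D : Set E} (hD : IsOpen D)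
    {F : ℕ → E → V} {f : E → V} (hF : ∀ k, DifferentiableOn ℝ (F k) D)
    (heq : ∀ k, ∀ y ∈ D, ∀ j, fderiv ℝ (F k) y (b j) = A j (fderiv ℝ (F k) y (b (σ j))))
    (hlim : ∀ K ⊆ D, IsCompact K → TendstoUniformlyOn F f atTop K) :
    DifferentiableOn ℝ f D ∧
      ∀ y ∈ D, ∀ j, fderiv ℝ f y (b j) = A j (fderiv ℝ f y (b (σ j))) := by
  have : FiniteDimensional ℝ E := b.finiteDimensional_of_finite
  let T : (Fin n → ℝ) ≃L[ℝ] E := b.equivFun.symm.toContinuousLinearEquiv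
  have hT : ∀ j, T (Pi.single j 1) = b j := fun j => by
    change b.equivFun.symm (Pi.single j 1) = b j
    simp [Module.Basis.equivFun_symm_apply, Pi.single_apply]
  have hTs : ∀ j, T.symm (b j) = Pi.single j 1 := fun j => by
    rw [ContinuousLinearEquiv.symm_apply_eq, hT]
  have hU : IsOpen (T ⁻¹' D) := hD.preimage T.continuous
  have hFd : ∀ k, ∀ x ∈ T ⁻¹' D, HasFDerivAt (F k ∘ T) (fderiv ℝ (F k) (T x) ∘L T) x :=
    fun k x hx => ((hF k).differentiableAt (hD.mem_nhds hx)).hasFDerivAt.comp x T.hasFDerivAt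
  have hFd' : ∀ k, DifferentiableOn ℝ (F k ∘ T) (T ⁻¹' D) := fun k x hx =>
    (hFd k x hx).differentiableAt.differentiableWithinAt
  have hweak : ∀ k, IsWeakSolution A σ (F k ∘ T) (T ⁻¹' D) := fun k =>
    isWeakSolution_of_differentiableOn hU (hFd' k) fun x hx j => by
      rw [(hFd k x hx).fderiv]
      simpa [hT] using heq k (T x) hx j
  have hlim' : ∀ K ⊆ T ⁻¹' D, IsCompact K →
      TendstoUniformlyOn (fun k => F k ∘ T) (f ∘ T) atTop K := fun K hK hKc =>
    ((hlim (T '' K) (image_subset_iff.2 hK) (hKc.image T.continuous)).comp T).mono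
      (subset_preimage_image _ _)
  have hfc : ContinuousOn (f ∘ T) (T ⁻¹' D) :=
    ((tendstoLocallyUniformlyOn_iff_forall_isCompact hU).2 hlim').continuousOn
      (Frequently.of_forall fun k => (hFd' k).continuousOn)
  have hw := IsWeakSolution.of_tendsto hU hweak (fun k => (hFd' k).continuousOn) hfc hlim'
  have key : ∀ y ∈ D, ∃ f' : E →L[ℝ] V, HasFDerivAt f f' y ∧
      ∀ j, f' (b j) = A j (f' (b (σ j))) := fun y hy => by
    obtain ⟨f', hf', h⟩ := hw.exists_hasFDerivAt hU hfc hA (y := T.symm y) (by simpa using hy)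
    refine ⟨f' ∘L (T.symm : E →L[ℝ] Fin n → ℝ), ?_, fun j => by simpa [hTs] using h j⟩
    have := hf'.comp y T.symm.hasFDerivAt
    rwa [comp_assoc, T.self_comp_symm, comp_id] at this
  refine ⟨fun y hy => ?_, fun y hy j => ?_⟩
  · obtain ⟨f', hf', -⟩ := key y hy
    exact hf'.differentiableAt.differentiableWithinAt
  · obtain ⟨f', hf', h⟩ := key y hy
    rw [hf'.fderiv, h j]

end Regularity

theorem sum_smulRight_coord_eq_zero_iff {ι M V : Type*} [Fintype ι] [AddCommGroup M] [Module ℝ M]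
    [AddCommGroup V] [Module ℝ V] (b : Module.Basis ι ℝ M) (s : Finset ι) (v : ι → V) :
    ∑ j ∈ s, (b.coord j).smulRight (v j) = 0 ↔ ∀ j ∈ s, v j = 0 := by
  classical
  refine ⟨fun h j hj => ?_, fun h => Finset.sum_eq_zero fun j hj => by simp [h j hj]⟩
  have := LinearMap.congr_fun h (b j)
  simpa [LinearMap.sum_apply, Finsupp.single_apply, ite_smul, hj] using this

/-! ### The even case as a first order system -/

section Even

variable {Λ : Type*} [NormedRing Λ] [NormedAlgebra ℝ Λ] {𝒜 : ZMod 2 → Submodule ℝ Λ} {p : ℕ}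

theorem dBarEven_eq_zero_iff {e : Module.Basis (Fin (p + 1)) ℝ (𝒜 0)} (he : ConditionA0 e)
    (f : 𝒜 0 → Λ) (y : 𝒜 0) :
    dBarEven e f y = 0 ↔ ∀ j, fderiv ℝ f y (e j) = (e j : Λ) * fderiv ℝ f y (e 0) := by
  have h := sum_smulRight_coord_eq_zero_iff e (Finset.univ.map (Fin.succEmb p))
    fun j => fderiv ℝ f y (e j) - (e j : Λ) * fderiv ℝ f y (e 0)
  rw [Finset.sum_map] at h
  refine h.trans ?_
  -- The equation for `j = 0`, absent from `d''`, is trivial because `e 0 = 1`.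
  simp [Fin.forall_fin_succ, he.1, sub_eq_zero]

end Even

/-! ### The odd case: blocks as fibres of `σ` -/

section Odd

variable {Λ : Type*} [NormedRing Λ] [NormedAlgebra ℝ Λ] {𝒜 : ZMod 2 → Submodule ℝ Λ} {q r : ℕ}

theorem OddBlockBasis.exists_block (B : OddBlockBasis 𝒜 q r) (j : Fin q) :
    ∃ k : Fin r, B.s k.castSucc ≤ (j : ℕ) ∧ (j : ℕ) < B.s k.succ := by
  by_contra! h
  have : ∀ k : Fin (r + 1), B.s k ≤ (j : ℕ) := fun k => by
    induction k using Fin.induction with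
    | zero => simp [B.s_zero]
    | succ k ih => exact h k ih
  have h1 := this (Fin.last r)
  rw [B.s_last] at h1
  exact absurd j.2 (by omega)

theorem OddBlockBasis.block_unique (B : OddBlockBasis 𝒜 q r) {j : ℕ} {k l : Fin r}
    (hk : B.s k.castSucc ≤ j ∧ j < B.s k.succ) (hl : B.s l.castSucc ≤ j ∧ j < B.s l.succ) :
    k = l := by
  have key : ∀ {k l : Fin r}, j < B.s k.succ → B.s l.castSucc ≤ j → l ≤ k := fun h1 h2 => by
    have := B.s_strictMono.lt_iff_lt.1 (h2.trans_lt h1)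
    exact Fin.castSucc_lt_succ_iff.1 this
  exact le_antisymm (key hl.2 hk.1) (key hk.2 hl.1)

/-- The index of the block that contains `j`. -/
noncomputable def OddBlockBasis.block (B : OddBlockBasis 𝒜 q r) (j : Fin q) : Fin r :=
  (B.exists_block j).choose

theorem OddBlockBasis.block_eq_iff (B : OddBlockBasis 𝒜 q r) (j : Fin q) (k : Fin r) :
    B.block j = k ↔ B.s k.castSucc ≤ (j : ℕ) ∧ (j : ℕ) < B.s k.succ :=
  ⟨fun h => h ▸ (B.exists_block j).choose_spec,
    fun h => B.block_unique (B.exists_block j).choose_spec h⟩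

theorem OddBlockBasis.block_start (B : OddBlockBasis 𝒜 q r) (k : Fin r) :
    B.block (B.start k) = k :=
  (B.block_eq_iff _ _).2 ⟨le_rfl, B.s_strictMono k.castSucc_lt_succ⟩

theorem OddBlockBasis.a_start_eq_one (B : OddBlockBasis 𝒜 q r) (k : Fin r) :
    B.a (B.start k) = 1 :=
  B.a_start k _ rfl

theorem dBarOdd_eq_zero_iff (B : OddBlockBasis 𝒜 q r) (f : 𝒜 1 → Λ) (θ : 𝒜 1) :
    dBarOdd B f θ = 0 ↔
      ∀ j, fderiv ℝ f θ (B.ε j) = B.a j * fderiv ℝ f θ (B.ε (B.start (B.block j))) := by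
  -- Only the indices that do not start a block occur in `d''`; at a start the equation is trivial
  -- because `a = 1`.
  have h := sum_smulRight_coord_eq_zero_iff B.ε {j | B.start (B.block j) ≠ j}
    fun j => fderiv ℝ f θ (B.ε j) - B.a j * fderiv ℝ f θ (B.ε (B.start (B.block j)))
  rw [← Finset.sum_fiberwise _ B.block] at h
  have hd : dBarOdd B f θ = ∑ k, ∑ j ∈ {j ∈ {j | B.start (B.block j) ≠ j} | B.block j = k},
      (B.ε.coord j).smulRight (fderiv ℝ f θ (B.ε j) -
        B.a j * fderiv ℝ f θ (B.ε (B.start (B.block j)))) := by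
    refine Finset.sum_congr rfl fun k _ => Finset.sum_congr ?_ fun j hj => ?_
    · ext j
      simp only [Finset.mem_filter, Finset.mem_univ, true_and]
      constructor
      · intro hj
        have hb := (B.block_eq_iff j k).2 ⟨hj.1.le, hj.2⟩
        refine ⟨fun h => ?_, hb⟩
        rw [hb] at h
        exact hj.1.ne (congrArg Fin.val h)
      · rintro ⟨hne, hb⟩
        have hj := (B.block_eq_iff j k).1 hb
        rw [hb] at hne
        exact ⟨lt_of_le_of_ne hj.1 fun h => hne (Fin.ext h), hj.2⟩
    · rw [(Finset.mem_filter.1 hj).2]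
  rw [hd, h]
  simp only [Finset.mem_filter, Finset.mem_univ, true_and, sub_eq_zero]
  refine ⟨fun h j => ?_, fun h j _ => h j⟩
  by_cases hj : B.start (B.block j) = j
  · have := B.a_start_eq_one (B.block j)
    rw [hj] at this ⊢
    rw [this, one_mul]
  · exact h j hj

/-- The fibre over a block start is the whole block, where `(A₁)` applies; every other fibre is
empty. -/
theorem ConditionA1.sum_start_block {B : OddBlockBasis 𝒜 q r} (hB : ConditionA1 B) (i : Fin q) :
    ∑ j with B.start (B.block j) = i, B.a j ^ 2 = 0 := by
  by_cases hi : B.start (B.block i) = i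
  · rw [← hB (B.block i)]
    refine Finset.sum_congr ?_ fun _ _ => rfl
    ext j
    simp only [Finset.mem_filter, Finset.mem_univ, true_and, ← B.block_eq_iff]
    refine ⟨fun h => ?_, fun h => h ▸ hi⟩
    rw [← h, B.block_start]
  · refine Finset.sum_eq_zero fun j hj => absurd ?_ hi
    rw [← (Finset.mem_filter.1 hj).2, B.block_start]

end Odd

end Superanalysis

theorem mainTheorem7 {Λ : Type*} [NormedRing Λ] [NormedAlgebra ℝ Λ] [FiniteDimensional ℝ Λ]
    (𝒜 : ZMod 2 → Submodule ℝ Λ) [GradedAlgebra 𝒜] (hΛ : Superanalysis.IsSupercommutative 𝒜)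
    {p q r : ℕ} (e : Module.Basis (Fin (p + 1)) ℝ (𝒜 0)) (hA0 : Superanalysis.ConditionA0 e)
    (B : Superanalysis.OddBlockBasis 𝒜 q r) (hA1 : Superanalysis.ConditionA1 B) :
    (∀ (D : Set (𝒜 0)) (F : ℕ → 𝒜 0 → Λ) (f : 𝒜 0 → Λ), IsOpen D →
      (∀ n, Superanalysis.QSDifferentiableOnEven e (F n) D) →
      (∀ K ⊆ D, IsCompact K → TendstoUniformlyOn F f Filter.atTop K) →
      Superanalysis.QSDifferentiableOnEven e f D) ∧
    (∀ (D : Set (𝒜 1)) (F : ℕ → 𝒜 1 → Λ) (f : 𝒜 1 → Λ), IsOpen D →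
      (∀ n, Superanalysis.QSDifferentiableOnOdd B (F n) D) →
      (∀ K ⊆ D, IsCompact K → TendstoUniformlyOn F f Filter.atTop K) →
      Superanalysis.QSDifferentiableOnOdd B f D) := by
  have : CompleteSpace Λ := FiniteDimensional.complete ℝ Λ
  refine ⟨fun D F f hD hF hlim => ?_, fun D F f hD hF hlim => ?_⟩
  · have h := Superanalysis.hasFDerivAt_of_tendstoUniformlyOn_compact
      (A := fun j => ContinuousLinearMap.mul ℝ Λ (e j : Λ)) (σ := fun _ => 0) e
      (fun i v => by
        by_cases hi : 0 = i
        · simp only [hi, Finset.filter_true, ContinuousLinearMap.mul_apply', ← mul_assoc, ← pow_two]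
          rw [← Finset.sum_mul, hA0.2, zero_mul]
        · simp [hi]) hD (fun k => (hF k).1)
      (fun k y hy => (Superanalysis.dBarEven_eq_zero_iff hA0 _ _).1 ((hF k).2 y hy)) hlim
    exact ⟨h.1, fun y hy => (Superanalysis.dBarEven_eq_zero_iff hA0 _ _).2 (h.2 y hy)⟩
  · have h := Superanalysis.hasFDerivAt_of_tendstoUniformlyOn_compact
      (A := fun j => ContinuousLinearMap.mul ℝ Λ (B.a j)) (σ := fun j => B.start (B.block j)) B.ε
      (fun i v => by
        simp only [ContinuousLinearMap.mul_apply', ← mul_assoc, ← pow_two]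
        rw [← Finset.sum_mul, hA1.sum_start_block, zero_mul]) hD (fun k => (hF k).1)
      (fun k y hy => (Superanalysis.dBarOdd_eq_zero_iff B _ _).1 ((hF k).2 y hy)) hlim
    exact ⟨h.1, fun y hy => (Superanalysis.dBarOdd_eq_zero_iff B _ _).2 (h.2 y hy)⟩
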